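/- **Lemma 2.1.** Let $E,F,V$ be finite-dimensional complex normed vector spaces, let $A(D)=\sum_{|\alpha|=\nu}a_\alpha\partial^\alpha$, $a_\alpha\in L(E,F)$, be a homogeneous linear differential operator of order $\nu$ with constant coefficients on $\mathbb R^N$ from $E$ to $F$, and let $A(\xi)=\sum_{|\alpha|=\nu}\xi^\alpha a_\alpha$ be its symbol. Assume that $A(D)$ is elliptic, i.e. $A(\xi):E\to F$ is injective for every $\xi\in\mathbb R^N\setminus\{0\}$, and canceling, i.e. $\bigcap_{\xi\in\mathbb R^N\setminus\{0\}}A(\xi)[E]=\{0\}$. Let $0<\ell<N$, $\ell\le\nu$ and $1\le q<\frac{N}{N-\ell}$. Let $K:\mathbb R^N\times\mathbb R^N\to L(F,V)$ be a locally integrable function such that $y\mapsto K(x,y)$ is differentiable on $\mathbb R^N\setminus\{x\}$ for every $x$ and, for some constant $C$, $$|K(x,y)|\le C|x-y|^{\ell-N},\qquad |\partial_yK(x,y)|\le C|x-y|^{\ell-N-1},\qquad x\ne y.$$ Then there is a constant $C'>0$ such that for every $u\in C_c^\infty(\mathbb R^N;E)$ the integral $\int_{\mathbb R^N}K(x,y)A(D)u(y)\,dy$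 converges absolutely for every $x\in\mathbb R^N$, the integral on the left-hand side below is finite, and $$\left(\int_{\mathbb R^N}\left|\int_{\mathbb R^N}K(x,y)A(D)u(y)\,dy\right|^q|x|^{-N+(N-\ell)q}\,dx\right)^{1/q}\le C'\int_{\mathbb R^N}|A(D)u(x)|\,dx .$$ -/

import Mathlib

open MeasureTheory
open scoped ContDiff

noncomputable section

namespace HardySobolev

/-- Euclidean space `ℝ^N`. -/
abbrev Space (N : ℕ) : Type := EuclideanSpace ℝ (Fin N)

/-- The partial derivative `∂_i u`. -/
def partialDeriv {N : ℕ} {E : Type*} [NormedAddCommGroup E] [NormedSpace ℂ E]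
    (i : Fin N) (u : Space N → E) : Space N → E :=
  fun x => fderiv ℝ u x (EuclideanSpace.single i (1 : ℝ))

/-- The partial derivative `∂^α u = ∂_1^{α_1} ⋯ ∂_N^{α_N} u` for a multi-index `α`. -/
def multiDeriv {N : ℕ} {E : Type*} [NormedAddCommGroup E] [NormedSpace ℂ E]
    (α : Fin N → ℕ) (u : Space N → E) : Space N → E :=
  (List.finRange N).foldr (fun i v => (partialDeriv i)^[α i] v) u

/-- The multi-indices of length `ν`. -/
def multiIndices (N ν : ℕ) : Finset (Fin N → ℕ) :=
  Finset.piAntidiag Finset.univ ν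

/-- A homogeneous linear differential operator `A(D) = ∑_{|α| = ν} a_α ∂^α` of order `ν` on `ℝ^N`
from `E` to `F` with constant coefficients `a_α ∈ L(E, F)`. -/
structure HomDiffOp (N ν : ℕ) (E F : Type*) [NormedAddCommGroup E] [NormedSpace ℂ E]
    [NormedAddCommGroup F] [NormedSpace ℂ F] where
  /-- The coefficients; only those with `α ∈ multiIndices N ν` are used. -/
  coeff : (Fin N → ℕ) → (E →L[ℂ] F)

namespace HomDiffOp

variable {N ν : ℕ} {E F : Type*} [NormedAddCommGroup E] [NormedSpace ℂ E]
  [NormedAddCommGroup F] [NormedSpace ℂ F]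

/-- The function `A(D)u`. -/
def apply (A : HomDiffOp N ν E F) (u : Space N → E) : Space N → F :=
  fun x => ∑ α ∈ multiIndices N ν, A.coeff α (multiDeriv α u x)

/-- The symbol `A(ξ) = ∑_{|α| = ν} ξ^α a_α`. (With the convention `D = -i∂` the operator and its
symbol only change by a constant unimodular factor, by homogeneity.) -/
def symbol (A : HomDiffOp N ν E F) (ξ : Space N) : E →L[ℂ] F :=
  ∑ α ∈ multiIndices N ν, ((∏ i, ξ i ^ α i : ℝ) : ℂ) • A.coeff α

/-- `A(D)` is elliptic: `A(ξ)` is injective for every real `ξ ≠ 0`. -/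
def IsElliptic (A : HomDiffOp N ν E F) : Prop :=
  ∀ ξ : Space N, ξ ≠ 0 → Function.Injective (A.symbol ξ)

/-- `A(D)` is canceling: `⋂_{ξ ≠ 0} A(ξ)[E] = {0}`. -/
def IsCanceling (A : HomDiffOp N ν E F) : Prop :=
  (⋂ ξ ∈ {ξ : Space N | ξ ≠ 0}, Set.range (A.symbol ξ)) = {0}

end HomDiffOp

end HardySobolev

end

/-! Put s = ℓ - N. Alone, |K(x,y)| ≤ C|x-y|^s is too weak for an L¹ bound, as it does not decay fast
enough for |x| much larger than |y|; cancellation supplies one more power of |y|/|x|.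

Ellipticity makes the projection along A(ξ)[E] smooth in ξ ≠ 0, and cancellation makes the averages
of such projections fill L(F,F). This yields a test function v with v(ξ)A(ξ) = 0 and ∫v = id
(`exists_isAnnihilator_integral_eq_id`). Its Fourier transform g is Schwartz, g(0) = id, and ∫ g(ry)
A(D)u(y) dy = 0 for all r (`exists_moment_kernel`).

Hence K(x,y) may be replaced by K(x,y) - K(x,0)g(y/|x|) without changing the integral. For 2|y| ≤
|x| the difference is O(|x|^(s-1)|y|); otherwise it is O(|x-y|^s + |x|^(s+1)/|y|)
(`enorm_sub_comp_le_majorant`). The L^q norm of this majorant in x, with the weight |x|^(-N-sq), is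
bounded uniformly in y by homogeneity (`isUniformlyBoundedKernel_majorant`), and Minkowski's
inequality concludes. -/

noncomputable section

namespace HardySobolev

open scoped FourierTransform ENNReal
open Metric

/-! ### Fourier transform of A(D)u and homogeneity of the symbol. -/

section Fourier

variable {N ν : ℕ} {E F : Type*} [NormedAddCommGroup E] [NormedSpace ℂ E]
  [NormedAddCommGroup F] [NormedSpace ℂ F]

theorem contDiff_partialDeriv {u : Space N → E} (hu : ContDiff ℝ ∞ u) (i : Fin N) :
    ContDiff ℝ ∞ (partialDeriv i u) :=
  (hu.fderiv_right (m := ∞) (by simp)).clm_apply contDiff_const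

theorem hasCompactSupport_partialDeriv {u : Space N → E} (hu : HasCompactSupport u) (i : Fin N) :
    HasCompactSupport (partialDeriv i u) :=
  (hu.fderiv ℝ).comp_left (g := fun T : Space N →L[ℝ] E => T (EuclideanSpace.single i (1 : ℝ)))
    (by simp)

theorem fourier_partialDeriv {u : Space N → E} (hu : ContDiff ℝ ∞ u) (hc : HasCompactSupport u)
    (i : Fin N) (ξ : Space N) :
    𝓕 (partialDeriv i u) ξ = (2 * Real.pi * Complex.I * (ξ i : ℂ)) • 𝓕 u ξ := by
  have hd : Continuous (fderiv ℝ u) := hu.continuous_fderiv (by simp)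
  have h1 : Integrable (fderiv ℝ u) := hd.integrable_of_hasCompactSupport (hc.fderiv ℝ)
  have h := congrFun (Real.fourier_fderiv (hu.continuous.integrable_of_hasCompactSupport hc)
    (hu.differentiable (by simp)) h1) ξ
  have h2 := congrArg (fun T : Space N →L[ℝ] E => T (EuclideanSpace.single i (1 : ℝ))) h
  have h3 : 𝓕 (partialDeriv i u) ξ
      = (𝓕 (fderiv ℝ u) ξ) (EuclideanSpace.single i (1 : ℝ)) := by
    rw [Real.fourier_continuousLinearMap_apply h1]
    rfl
  rw [h3]
  refine h2.trans ?_
  rw [VectorFourier.fourierSMulRight_apply]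
  have h4 : (innerSL ℝ ξ) (EuclideanSpace.single i (1 : ℝ)) = ξ i := by
    simp [innerSL_apply_apply, EuclideanSpace.inner_single_right]
  rw [neg_apply, neg_apply, h4, neg_smul, neg_smul,
    smul_neg, neg_neg, ← Complex.coe_smul, smul_smul]

/-- `v` is a smooth compactly supported function whose Fourier transform is `c` times that of
`u`. -/
structure IsFourierMultiple (u v : Space N → E) (c : Space N → ℂ) : Prop where
  contDiff : ContDiff ℝ ∞ v
  hasCompactSupport : HasCompactSupport v
  fourier_eq : ∀ ξ, 𝓕 v ξ = c ξ • 𝓕 u ξ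

theorem IsFourierMultiple.partialDeriv {u v : Space N → E} {c : Space N → ℂ}
    (h : IsFourierMultiple u v c) (i : Fin N) :
    IsFourierMultiple u (partialDeriv i v)
      (fun ξ => (2 * Real.pi * Complex.I * (ξ i : ℂ)) * c ξ) :=
  ⟨contDiff_partialDeriv h.contDiff i, hasCompactSupport_partialDeriv h.hasCompactSupport i,
    fun ξ => by rw [fourier_partialDeriv h.contDiff h.hasCompactSupport, h.fourier_eq, smul_smul]⟩

theorem IsFourierMultiple.iterate_partialDeriv {u v : Space N → E} {c : Space N → ℂ}
    (h : IsFourierMultiple u v c) (i : Fin N) (n : ℕ) :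
    IsFourierMultiple u ((HardySobolev.partialDeriv i)^[n] v)
      (fun ξ => (2 * Real.pi * Complex.I * (ξ i : ℂ)) ^ n * c ξ) := by
  induction n with
  | zero => simpa using h
  | succ n ih =>
    rw [Function.iterate_succ_apply']
    convert ih.partialDeriv i using 2 with ξ
    ring

/-- An arbitrary list replaces `List.finRange N` so that induction applies. -/
theorem isFourierMultiple_foldr {u : Space N → E} (hu : ContDiff ℝ ∞ u)
    (hc : HasCompactSupport u) (α : Fin N → ℕ) (s : List (Fin N)) :
    IsFourierMultiple u (s.foldr (fun i v => (partialDeriv i)^[α i] v) u)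
      (fun ξ => (s.map fun i => (2 * Real.pi * Complex.I * (ξ i : ℂ)) ^ α i).prod) := by
  induction s with
  | nil => exact ⟨hu, hc, fun ξ => by simp⟩
  | cons i s ih => simpa using ih.iterate_partialDeriv i (α i)

theorem isFourierMultiple_multiDeriv {u : Space N → E} (hu : ContDiff ℝ ∞ u)
    (hc : HasCompactSupport u) {α : Fin N → ℕ} (hα : α ∈ multiIndices N ν) :
    IsFourierMultiple u (multiDeriv α u)
      (fun ξ => (2 * Real.pi * Complex.I) ^ ν * ((∏ i, ξ i ^ α i : ℝ) : ℂ)) := by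
  have h := isFourierMultiple_foldr hu hc α (List.finRange N)
  refine ⟨h.contDiff, h.hasCompactSupport, fun ξ => (h.fourier_eq ξ).trans ?_⟩
  congr 1
  have hs : ∑ i, α i = ν := by simpa [multiIndices] using hα
  rw [← List.ofFn_eq_map, List.prod_ofFn, ← hs, ← Finset.prod_pow_eq_pow_sum]
  push_cast
  rw [← Finset.prod_mul_distrib]
  simp_rw [mul_pow]

namespace HomDiffOp

variable (A : HomDiffOp N ν E F)

theorem continuous_apply {u : Space N → E} (hu : ContDiff ℝ ∞ u) (hc : HasCompactSupport u) :
    Continuous (A.apply u) :=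
  continuous_finsetSum _ fun α hα => (A.coeff α).continuous.comp
    (isFourierMultiple_multiDeriv hu hc hα).contDiff.continuous

theorem hasCompactSupport_apply {u : Space N → E} (hu : ContDiff ℝ ∞ u)
    (hc : HasCompactSupport u) : HasCompactSupport (A.apply u) := by
  have : ∀ s ⊆ multiIndices N ν,
      HasCompactSupport (fun x => ∑ α ∈ s, A.coeff α (multiDeriv α u x)) := by
    intro s
    induction s using Finset.induction_on with
    | empty => intro _; exact HasCompactSupport.zero
    | insert a s ha ih =>
      intro hs
      simp_rw [Finset.sum_insert ha]
      refine HasCompactSupport.add ?_ (ih fun x hx => hs (Finset.mem_insert_of_mem hx))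
      exact (isFourierMultiple_multiDeriv hu hc
        (hs (Finset.mem_insert_self a s))).hasCompactSupport.comp_left (map_zero _)
  exact this _ subset_rfl

/-- What matters later is that this value lies in the range of A(ξ). -/
theorem fourier_apply [CompleteSpace E] [CompleteSpace F]
    {u : Space N → E} (hu : ContDiff ℝ ∞ u) (hc : HasCompactSupport u)
    (ξ : Space N) :
    𝓕 (A.apply u) ξ = A.symbol ξ ((2 * Real.pi * Complex.I) ^ ν • 𝓕 u ξ) := by
  have hI : ∀ α ∈ multiIndices N ν, Integrable (multiDeriv α u) := fun α hα =>
    (isFourierMultiple_multiDeriv hu hc hα).contDiff.continuous.integrable_of_hasCompactSupport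
      (isFourierMultiple_multiDeriv hu hc hα).hasCompactSupport
  have h1 : 𝓕 (A.apply u) ξ
      = ∑ α ∈ multiIndices N ν, A.coeff α (𝓕 (multiDeriv α u) ξ) := by
    simp only [Real.fourier_eq, apply, Finset.smul_sum]
    rw [integral_finsetSum]
    · refine Finset.sum_congr rfl fun α hα => ?_
      rw [← ContinuousLinearMap.integral_comp_comm]
      · simp only [Circle.smul_def, map_smul]
      · exact (Real.fourierIntegral_convergent_iff ξ).2 (hI α hα)
    · intro α hα
      exact (Real.fourierIntegral_convergent_iff ξ).2 ((A.coeff α).integrable_comp (hI α hα))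
  rw [h1, symbol, sum_apply]
  refine Finset.sum_congr rfl fun α hα => ?_
  rw [(isFourierMultiple_multiDeriv hu hc hα).fourier_eq]
  simp only [map_smul, smul_apply, smul_smul]

theorem symbol_smul (r : ℝ) (ξ : Space N) : A.symbol (r • ξ) = r ^ ν • A.symbol ξ := by
  rw [symbol, symbol, Finset.smul_sum]
  refine Finset.sum_congr rfl fun α hα => ?_
  have hs : ∑ i, α i = ν := by simpa [multiIndices] using hα
  have hp : ∏ i, (r • ξ) i ^ α i = r ^ ν * ∏ i, ξ i ^ α i := by
    simp [mul_pow, Finset.prod_mul_distrib, Finset.prod_pow_eq_pow_sum, hs]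
  rw [hp, Complex.ofReal_mul, mul_smul, Complex.coe_smul]

theorem contDiff_symbol : ContDiff ℝ ∞ A.symbol := by
  unfold symbol
  refine ContDiff.sum fun α _ => ContDiff.fun_smul ?_ contDiff_const
  have h : ∀ i, ContDiff ℝ ∞ (fun ξ : Space N => ξ i) := fun i =>
    (EuclideanSpace.proj (𝕜 := ℝ) i).contDiff
  have hp : ContDiff ℝ ∞ (fun ξ : Space N => ∏ i, ξ i ^ α i) :=
    contDiff_prod fun i _ => (h i).pow _
  exact Complex.ofRealCLM.contDiff.comp hp

end HomDiffOp

end Fourier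

/-! ### Test functions annihilating the range of the symbol, and their integrals. -/

section Annihilator

variable {N ν : ℕ} {E F G H : Type*} [NormedAddCommGroup E] [NormedSpace ℂ E]
  [NormedAddCommGroup F] [NormedSpace ℂ F] [NormedAddCommGroup G] [NormedSpace ℂ G]
  [NormedAddCommGroup H] [NormedSpace ℂ H]

/-- `v` is a test function whose value at each `ξ` vanishes on the range of `A(ξ)`. -/
structure HomDiffOp.IsAnnihilator (A : HomDiffOp N ν E F) (v : Space N → F →L[ℂ] G) : Prop where
  contDiff : ContDiff ℝ ∞ v
  hasCompactSupport : HasCompactSupport v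
  comp_symbol : ∀ ξ x, v ξ (A.symbol ξ x) = 0

namespace HomDiffOp

variable {A : HomDiffOp N ν E F}

theorem IsAnnihilator.integrable {v : Space N → F →L[ℂ] G} (hv : A.IsAnnihilator v) :
    Integrable v :=
  hv.contDiff.continuous.integrable_of_hasCompactSupport hv.hasCompactSupport

theorem IsAnnihilator.zero : A.IsAnnihilator (fun _ => (0 : F →L[ℂ] G)) :=
  ⟨contDiff_const, HasCompactSupport.zero, fun _ _ => rfl⟩

theorem IsAnnihilator.add {v w : Space N → F →L[ℂ] G} (hv : A.IsAnnihilator v)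
    (hw : A.IsAnnihilator w) : A.IsAnnihilator (fun ξ => v ξ + w ξ) :=
  ⟨hv.contDiff.add hw.contDiff, hv.hasCompactSupport.add hw.hasCompactSupport,
    fun ξ x => by simp [hv.comp_symbol, hw.comp_symbol]⟩

theorem IsAnnihilator.map {v : Space N → F →L[ℂ] G} (hv : A.IsAnnihilator v)
    (T : (F →L[ℂ] G) →L[ℂ] (F →L[ℂ] H))
    (hT : ∀ S x, S x = 0 → T S x = 0) : A.IsAnnihilator (fun ξ => T (v ξ)) :=
  ⟨(T.restrictScalars ℝ).contDiff.comp hv.contDiff,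
    hv.hasCompactSupport.comp_left (map_zero T),
    fun ξ x => hT _ _ (hv.comp_symbol ξ x)⟩

theorem IsAnnihilator.sum {ι : Type*} (s : Finset ι) {v : ι → Space N → F →L[ℂ] G}
    (hv : ∀ i ∈ s, A.IsAnnihilator (v i)) : A.IsAnnihilator (fun ξ => ∑ i ∈ s, v i ξ) := by
  classical
  induction s using Finset.induction_on with
  | empty => simpa using IsAnnihilator.zero
  | insert a s ha ih =>
    simp_rw [Finset.sum_insert ha]
    exact (hv a (Finset.mem_insert_self a s)).add
      (ih fun i hi => hv i (Finset.mem_insert_of_mem hi))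

/-- A vector outside the range of `A(ξ₀)` is detected by some annihilator supported
near `ξ₀`. -/
theorem exists_isAnnihilator_integral_apply_ne_zero [FiniteDimensional ℂ E]
    [FiniteDimensional ℂ F] {ξ₀ : Space N} (hinj : Function.Injective (A.symbol ξ₀)) {w : F}
    (hw : w ∉ Set.range (A.symbol ξ₀)) :
    ∃ v : Space N → F →L[ℂ] ℂ, A.IsAnnihilator v ∧ (∫ ξ, v ξ) w ≠ 0 := by
  have : CompleteSpace E := FiniteDimensional.complete ℂ E
  obtain ⟨B', hB'⟩ := LinearMap.exists_leftInverse_of_injective (A.symbol ξ₀).toLinearMap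
    (LinearMap.ker_eq_bot.2 hinj)
  let B : F →L[ℂ] E := LinearMap.toContinuousLinearMap B'
  have hB : ∀ x, B (A.symbol ξ₀ x) = x := fun x => LinearMap.congr_fun hB' x
  -- M(ξ₀) = id, so M(ξ) is invertible near ξ₀; there P(ξ) = 1 - A(ξ)M(ξ)⁻¹B is a projection with
  -- kernel A(ξ)[E]. Where M(ξ) is singular, `Ring.inverse` is 0 and P has no meaning; the cutoff χ
  -- removes those points.
  let M : Space N → (E →L[ℂ] E) := fun ξ => B ∘L A.symbol ξ
  have hM0 : M ξ₀ = 1 := by ext x; exact hB x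
  let P : Space N → (F →L[ℂ] F) := fun ξ => 1 - A.symbol ξ ∘L (Ring.inverse (M ξ)) ∘L B
  have hPA : ∀ ξ, IsUnit (M ξ) → ∀ x, P ξ (A.symbol ξ x) = 0 := by
    intro ξ hξ x
    have h := DFunLike.congr_fun (Ring.inverse_mul_cancel (M ξ) hξ) x
    change Ring.inverse (M ξ) (B (A.symbol ξ x)) = x at h
    change A.symbol ξ x - A.symbol ξ (Ring.inverse (M ξ) (B (A.symbol ξ x))) = 0
    rw [h, sub_self]
  have hP0 : P ξ₀ w ≠ 0 := by
    change w - A.symbol ξ₀ (Ring.inverse (M ξ₀) (B w)) ≠ 0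
    exact fun h => hw ⟨_, (sub_eq_zero.1 h).symm⟩
  obtain ⟨e, he⟩ := SeparatingDual.exists_eq_one (R := ℂ) hP0
  have hM : ContDiff ℝ ∞ M :=
    (((ContinuousLinearMap.compL ℂ E F E B).restrictScalars ℝ).contDiff).comp A.contDiff_symbol
  have hP : ∀ ξ, IsUnit (M ξ) → ContDiffAt ℝ ∞ P ξ := by
    rintro ξ ⟨m, hm⟩
    have h1 : ContDiffAt ℝ ∞ (fun ξ => Ring.inverse (M ξ)) ξ := by
      refine ContDiffAt.comp ξ (g := Ring.inverse) ?_ hM.contDiffAt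
      rw [← hm]
      exact (contDiffAt_ringInverse ℂ m).restrict_scalars ℝ
    have h2 : ContDiffAt ℝ ∞ (fun ξ => Ring.inverse (M ξ) ∘L B) ξ :=
      ((((ContinuousLinearMap.compL ℂ F E E).flip B).restrictScalars ℝ).contDiff.contDiffAt).comp
        ξ h1
    have h3 : ContDiffAt ℝ ∞ (fun ξ => A.symbol ξ ∘L (Ring.inverse (M ξ) ∘L B)) ξ := by
      have hb : IsBoundedBilinearMap ℝ
          (fun p : (E →L[ℂ] F) × (F →L[ℂ] E) => p.1 ∘L p.2) :=
        { add_left := fun _ _ _ => by ext; simp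
          smul_left := fun _ _ _ => by ext; simp
          add_right := fun _ _ _ => by ext; simp
          smul_right := fun c x y => by ext z; simp
          bound := ⟨1, one_pos, fun x y => by
            rw [one_mul]; exact ContinuousLinearMap.opNorm_comp_le x y⟩ }
      exact hb.contDiff.contDiffAt.comp ξ (A.contDiff_symbol.contDiffAt.prodMk h2)
    exact contDiffAt_const.sub h3
  have hMo : IsOpen {ξ | IsUnit (M ξ)} := Units.isOpen.preimage hM.continuous
  have hMmem : IsUnit (M ξ₀) := hM0 ▸ isUnit_one
  let φ : Space N → F →L[ℂ] ℂ := fun ξ => e ∘L P ξ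
  have hφ : ∀ ξ, IsUnit (M ξ) → ContDiffAt ℝ ∞ φ ξ := fun ξ hξ =>
    (((ContinuousLinearMap.compL ℂ F F ℂ e).restrictScalars ℝ).contDiff.contDiffAt).comp ξ
      (hP ξ hξ)
  have hre : ∀ᶠ ξ in nhds ξ₀, 0 < (φ ξ w).re := by
    have hc : ContinuousAt (fun ξ => (φ ξ w).re) ξ₀ :=
      Complex.continuous_re.continuousAt.comp
        ((ContinuousLinearMap.apply ℂ ℂ w).continuous.continuousAt.comp
          (hφ ξ₀ hMmem).continuousAt)
    refine hc.eventually_const_lt ?_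
    change 0 < (e (P ξ₀ w)).re
    simp [he]
  -- On the support of χ the real part of φ(ξ)w is positive, so no cancellation can occur in the
  -- integral.
  obtain ⟨χ, hχs, hχc, hχd, hχr, hχ1⟩ := exists_contDiff_tsupport_subset (n := ⊤)
    (Filter.inter_mem (hMo.mem_nhds hMmem) hre)
  have hχ0 : ∀ ξ, 0 ≤ χ ξ := fun ξ => (hχr ⟨ξ, rfl⟩).1
  have hχz : ∀ ξ, χ ξ ≠ 0 → IsUnit (M ξ) ∧ 0 < (φ ξ w).re := fun ξ hξ =>
    hχs (subset_tsupport _ hξ)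
  have hv : A.IsAnnihilator (fun ξ => χ ξ • φ ξ) := by
    refine ⟨contDiff_iff_contDiffAt.2 fun ξ => ?_, hχc.smul_right, fun ξ x => ?_⟩
    · by_cases hξ : ξ ∈ tsupport χ
      · exact hχd.contDiffAt.fun_smul (hφ ξ (hχs hξ).1)
      · refine (contDiffAt_const (c := (0 : F →L[ℂ] ℂ))).congr_of_eventuallyEq ?_
        filter_upwards [notMem_tsupport_iff_eventuallyEq.1 hξ] with y hy
        rw [hy]
        exact zero_smul ℝ (φ y)
    · by_cases hξ : χ ξ = 0
      · simp [hξ]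
      · change χ ξ • e (P ξ (A.symbol ξ x)) = 0
        rw [hPA ξ (hχz ξ hξ).1, map_zero, smul_zero]
  refine ⟨_, hv, fun h => ?_⟩
  rw [ContinuousLinearMap.integral_apply hv.integrable] at h
  have hcont : Continuous fun ξ => (χ ξ • φ ξ) w :=
    (ContinuousLinearMap.apply ℂ ℂ w).continuous.comp hv.contDiff.continuous
  have hsupp : HasCompactSupport fun ξ => (χ ξ • φ ξ) w :=
    hv.hasCompactSupport.comp_left (g := fun T : F →L[ℂ] ℂ => T w) rfl
  have hpos : 0 < ∫ ξ, ((χ ξ • φ ξ) w).re := by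
    refine Continuous.integral_pos_of_hasCompactSupport_nonneg_nonzero (x := ξ₀)
      (Complex.continuous_re.comp hcont) (hsupp.comp_left Complex.zero_re) (fun ξ => ?_) ?_
    · by_cases hξ : χ ξ = 0
      · simp [hξ]
      · simpa using mul_nonneg (hχ0 ξ) (hχz ξ hξ).2.le
    · have : (χ ξ₀ • φ ξ₀) w = 1 := by
        rw [hχ1, one_smul]; exact he
      simp [this]
  have := integral_re (𝕜 := ℂ) (hcont.integrable_of_hasCompactSupport (μ := volume) hsupp)
  simp only [RCLike.re_eq_complex_re] at this
  rw [this, h] at hpos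
  simp at hpos

/-- Duality: the attainable integrals form a subspace W of F*. If W were proper, a nonzero
functional on F* would vanish on it; by reflexivity it is evaluation at some w. Then w lies in every
A(ξ)[E], ξ ≠ 0, since otherwise an annihilator would detect it, and cancellation forces w = 0. -/
theorem exists_isAnnihilator_integral_eq [FiniteDimensional ℂ E] [FiniteDimensional ℂ F]
    (hell : A.IsElliptic) (hcan : A.IsCanceling) (e : F →L[ℂ] ℂ) :
    ∃ v : Space N → F →L[ℂ] ℂ, A.IsAnnihilator v ∧ ∫ ξ, v ξ = e := by
  let W : Submodule ℂ (F →L[ℂ] ℂ) :=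
    { carrier := {e | ∃ v : Space N → F →L[ℂ] ℂ, A.IsAnnihilator v ∧ ∫ ξ, v ξ = e}
      zero_mem' := ⟨_, IsAnnihilator.zero, by simp⟩
      add_mem' := by
        rintro _ _ ⟨v, hv, rfl⟩ ⟨w, hw, rfl⟩
        exact ⟨_, hv.add hw, integral_add hv.integrable hw.integrable⟩
      smul_mem' := by
        rintro c _ ⟨v, hv, rfl⟩
        exact ⟨_, hv.map (c • ContinuousLinearMap.id ℂ _) (fun S x h => by simp [h]),
          integral_smul c v⟩ }
  suffices W = ⊤ from (this ▸ Submodule.mem_top : e ∈ W)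
  by_contra hW
  obtain ⟨f, hf0, hf⟩ := Submodule.exists_le_ker_of_lt_top W (lt_top_iff_ne_top.2 hW)
  let w : F := (Module.evalEquiv ℂ F).symm
    (f ∘ₗ (LinearMap.toContinuousLinearMap (𝕜 := ℂ) (E := F) (F' := ℂ)).toLinearMap)
  have hw : ∀ e : F →L[ℂ] ℂ, f e = e w := by
    intro e
    have h := Module.apply_evalEquiv_symm_apply (R := ℂ) (M := F) e.toLinearMap
      (f ∘ₗ (LinearMap.toContinuousLinearMap (𝕜 := ℂ) (E := F) (F' := ℂ)).toLinearMap)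
    exact h.symm
  have hwmem : w ∈ ⋂ ξ ∈ {ξ : Space N | ξ ≠ 0}, Set.range (A.symbol ξ) := by
    simp only [Set.mem_iInter]
    intro ξ hξ
    by_contra hcon
    obtain ⟨v, hv, hne⟩ := exists_isAnnihilator_integral_apply_ne_zero (hell ξ hξ) hcon
    exact hne ((hw _).symm.trans (hf ⟨v, hv, rfl⟩))
  rw [hcan] at hwmem
  refine hf0 (LinearMap.ext fun e => ?_)
  rw [hw, Set.mem_singleton_iff.1 hwmem]
  simp

/-- Write id = ∑ bᵢ* ⊗ bᵢ in a basis of F and realise each coordinate functional bᵢ* as an integral.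
-/
theorem exists_isAnnihilator_integral_eq_id [FiniteDimensional ℂ E] [FiniteDimensional ℂ F]
    (hell : A.IsElliptic) (hcan : A.IsCanceling) :
    ∃ v : Space N → F →L[ℂ] F, A.IsAnnihilator v ∧ ∫ ξ, v ξ = ContinuousLinearMap.id ℂ F := by
  have : CompleteSpace F := FiniteDimensional.complete ℂ F
  let b := Module.finBasis ℂ F
  choose v hv hvi using fun i => exists_isAnnihilator_integral_eq hell hcan
    (LinearMap.toContinuousLinearMap (b.coord i))
  let T := fun i => (ContinuousLinearMap.smulRightL ℂ F F).flip (b i)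
  have hT : ∀ i, A.IsAnnihilator (fun ξ => T i (v i ξ)) := fun i =>
    (hv i).map (T i) fun S x h => by simp [T, h]
  refine ⟨_, IsAnnihilator.sum Finset.univ fun i _ => hT i, ?_⟩
  rw [integral_finsetSum _ fun i _ => (hT i).integrable]
  ext x
  simp_rw [fun i => ContinuousLinearMap.integral_comp_comm (T i) (hv i).integrable, hvi]
  rw [sum_apply]
  simp [T]

end HomDiffOp

end Annihilator

/-! ### The multiplier g orthogonal to all A(D)u. -/

section MomentKernel

variable {N ν : ℕ} {E F : Type*} [NormedAddCommGroup E] [NormedSpace ℂ E]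
  [NormedAddCommGroup F] [NormedSpace ℂ F]

namespace HomDiffOp

variable {A : HomDiffOp N ν E F}

/-- By Fubini the transform passes to the other factor, giving ∫ v(ξ) 𝓕(A(D)u)(rξ) dξ. By
homogeneity 𝓕(A(D)u)(rξ) lies in A(ξ)[E], where v(ξ) vanishes. -/
theorem IsAnnihilator.integral_fourier_smul_apply [CompleteSpace E] [CompleteSpace F]
    {v : Space N → F →L[ℂ] F} (hv : A.IsAnnihilator v) {u : Space N → E}
    (hu : ContDiff ℝ ∞ u) (hc : HasCompactSupport u) (r : ℝ) :
    ∫ y, 𝓕 v (r • y) (A.apply u y) = 0 := by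
  have hf : Integrable (A.apply u) := (A.continuous_apply hu hc).integrable_of_hasCompactSupport
    (A.hasCompactSupport_apply hu hc)
  -- Building r into the pairing treats every real r, including 0, with no change of variables.
  let L : Space N →L[ℝ] Space N →L[ℝ] ℝ := r • innerSL ℝ
  have hL : ∀ x y, L x y = r * inner ℝ x y := fun _ _ => rfl
  have h := VectorFourier.integral_bilin_fourierIntegral_eq_flip (μ := volume) (ν := volume)
    (L := L.toLinearMap₁₂) (ContinuousLinearMap.id ℂ (F →L[ℂ] F)) Real.continuous_fourierChar
    (by simp only [ContinuousLinearMap.toLinearMap₁₂_apply_apply_apply]; fun_prop) hv.integrable hf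
  have h1 : ∀ y, 𝓕 v (r • y)
      = VectorFourier.fourierIntegral Real.fourierChar volume L.toLinearMap₁₂ v y := fun y => by
    simp [Real.fourier_eq, VectorFourier.fourierIntegral, hL, inner_smul_right]
  have h2 : ∀ ξ, VectorFourier.fourierIntegral Real.fourierChar volume L.toLinearMap₁₂.flip
      (A.apply u) ξ = 𝓕 (A.apply u) (r • ξ) := fun ξ => by
    simp [Real.fourier_eq, VectorFourier.fourierIntegral, hL, inner_smul_right,
      real_inner_comm]
  simp_rw [h1]
  refine h.trans (integral_eq_zero_of_ae (Filter.Eventually.of_forall fun ξ => ?_))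
  simp only [ContinuousLinearMap.id_apply, Pi.zero_apply]
  rw [h2, A.fourier_apply hu hc, A.symbol_smul, smul_apply, ← Complex.coe_smul, map_smul,
    hv.comp_symbol, smul_zero]

/-- For an elliptic canceling operator there is a rapidly decreasing multiplier, equal to the
identity at the origin, all of whose dilations are orthogonal to the range of the operator. -/
theorem exists_moment_kernel [FiniteDimensional ℂ E] [FiniteDimensional ℂ F]
    (hell : A.IsElliptic) (hcan : A.IsCanceling) :
    ∃ (g : Space N → F →L[ℂ] F) (c : ℝ), Continuous g ∧ 0 ≤ c ∧
      (∀ z, ‖g z - ContinuousLinearMap.id ℂ F‖ ≤ c * ‖z‖) ∧ (∀ z, ‖z‖ * ‖g z‖ ≤ c) ∧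
      ∀ u : Space N → E, ContDiff ℝ ∞ u → HasCompactSupport u → ∀ r : ℝ,
        ∫ y, g (r • y) (A.apply u y) = 0 := by
  have : CompleteSpace E := FiniteDimensional.complete ℂ E
  have : CompleteSpace F := FiniteDimensional.complete ℂ F
  obtain ⟨v, hv, hvi⟩ := exists_isAnnihilator_integral_eq_id hell hcan
  let s : SchwartzMap (Space N) (F →L[ℂ] F) :=
    𝓕 (hv.hasCompactSupport.toSchwartzMap hv.contDiff)
  have hs : ∀ z, s z = 𝓕 v z := fun z => rfl
  -- The bound on the derivative makes g Lipschitz, which controls g - id; the other seminorm bounds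
  -- ‖z‖‖g z‖.
  obtain ⟨c₁, hc₁, h₁⟩ := s.decay 0 1
  obtain ⟨c₂, hc₂, h₂⟩ := s.decay 1 0
  refine ⟨s, max c₁ c₂, s.continuous, hc₁.le.trans (le_max_left _ _), fun z => ?_, fun z => ?_,
    fun u hu hc r => hv.integral_fourier_smul_apply hu hc r⟩
  · have h0 : s 0 = ContinuousLinearMap.id ℂ F := by
      rw [hs, Real.fourier_eq, ← hvi]
      simp
    rw [← h0]
    have h := Convex.norm_image_sub_le_of_norm_fderiv_le (𝕜 := ℝ) (f := s) (C := c₁)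
      (s := Set.univ) (fun x _ => s.differentiableAt)
      (fun x _ => by simpa [norm_iteratedFDeriv_one] using h₁ x) convex_univ
      (Set.mem_univ 0) (Set.mem_univ z)
    rw [sub_zero] at h
    exact h.trans (by gcongr; exact le_max_left _ _)
  · simpa using (h₂ z).trans (le_max_right _ _)

end HomDiffOp

end MomentKernel

/-! ### Minkowski's inequality and integrals of powers of |x|. -/

section Weights

/-- Comparison of the L¹ and L^q norms of k for the measure f dμ, whose total mass is ∫ f. -/
theorem lintegral_rpow_mul_le {α : Type*} [MeasurableSpace α] {μ : Measure α} {q : ℝ}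
    (hq : 1 ≤ q) {k f : α → ℝ≥0∞} (hk : Measurable k) (hf : Measurable f) :
    (∫⁻ y, k y * f y ∂μ) ^ q ≤ (∫⁻ y, k y ^ q * f y ∂μ) * (∫⁻ y, f y ∂μ) ^ (q - 1) := by
  have hq0 : 0 < q := by linarith
  have h := eLpNorm'_le_eLpNorm'_mul_rpow_measure_univ (μ := μ.withDensity f) one_pos hq
    hk.aestronglyMeasurable
  simp only [eLpNorm', enorm_eq_self, ENNReal.rpow_one, div_one] at h
  rw [lintegral_withDensity_eq_lintegral_mul _ hf hk,
    lintegral_withDensity_eq_lintegral_mul _ hf (hk.pow_const q),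
    withDensity_apply _ MeasurableSet.univ, Measure.restrict_univ] at h
  simp only [Pi.mul_apply] at h
  simp_rw [mul_comm (k _), mul_comm (k _ ^ q)]
  refine (ENNReal.rpow_le_rpow h hq0.le).trans_eq ?_
  rw [ENNReal.mul_rpow_of_nonneg _ _ hq0.le, ← ENNReal.rpow_mul, ← ENNReal.rpow_mul,
    one_div_mul_cancel hq0.ne', ENNReal.rpow_one, sub_mul, one_mul, one_div_mul_cancel hq0.ne']

/-- A weighted Minkowski integral inequality for positive kernels. -/
theorem lintegral_lintegral_rpow_le {α β : Type*} [MeasurableSpace α] [MeasurableSpace β]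
    {μ : Measure α} {η : Measure β} [SFinite μ] [SFinite η] {q : ℝ} (hq : 1 ≤ q)
    {k : α → β → ℝ≥0∞} (hk : Measurable (Function.uncurry k)) {w : α → ℝ≥0∞} (hw : Measurable w)
    {f : β → ℝ≥0∞} (hf : Measurable f) {M : ℝ≥0∞}
    (hM : ∀ᵐ y ∂η, ∫⁻ x, k x y ^ q * w x ∂μ ≤ M) :
    ∫⁻ x, (∫⁻ y, k x y * f y ∂η) ^ q * w x ∂μ ≤ M * (∫⁻ y, f y ∂η) ^ q := by
  set I := ∫⁻ y, f y ∂η with hI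
  have hkq : Measurable (Function.uncurry fun x y => k x y ^ q) := hk.pow_const q
  have hkx : ∀ x, Measurable (k x) := fun x => hk.of_uncurry_left
  have hky : ∀ y, Measurable (fun x => k x y ^ q) := fun y => hkq.of_uncurry_right
  calc ∫⁻ x, (∫⁻ y, k x y * f y ∂η) ^ q * w x ∂μ
      ≤ ∫⁻ x, (∫⁻ y, k x y ^ q * w x * f y ∂η) * I ^ (q - 1) ∂μ := by
        refine lintegral_mono fun x => ?_
        calc (∫⁻ y, k x y * f y ∂η) ^ q * w x
            ≤ ((∫⁻ y, k x y ^ q * f y ∂η) * I ^ (q - 1)) * w x := by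
              gcongr
              exact lintegral_rpow_mul_le hq (hkx x) hf
          _ = _ := by
              have hm : Measurable fun y => k x y ^ q * f y := ((hkx x).pow_const q).mul hf
              rw [mul_right_comm, ← lintegral_mul_const _ hm]
              simp_rw [mul_right_comm]
    _ = (∫⁻ y, (∫⁻ x, k x y ^ q * w x ∂μ) * f y ∂η) * I ^ (q - 1) := by
        have hm : Measurable (Function.uncurry fun x y => k x y ^ q * w x * f y) :=
          (hkq.mul (hw.comp measurable_fst)).mul (hf.comp measurable_snd)
        rw [lintegral_mul_const _ hm.lintegral_prod_right, lintegral_lintegral_swap hm.aemeasurable]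
        congr 1
        refine lintegral_congr fun y => ?_
        have hm' : Measurable fun x => k x y ^ q * w x := (hky y).mul hw
        rw [lintegral_mul_const _ hm']
    _ ≤ (∫⁻ y, M * f y ∂η) * I ^ (q - 1) := by
        gcongr ?_ * _
        refine lintegral_mono_ae ?_
        filter_upwards [hM] with y hy
        gcongr
    _ = M * I ^ q := by
        rw [lintegral_const_mul _ hf, mul_assoc, ← hI]
        congr 1
        have h := ENNReal.rpow_add_of_nonneg (x := I) 1 (q - 1) zero_le_one (by linarith)
        rwa [add_sub_cancel, ENNReal.rpow_one, eq_comm] at h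

section Scaling

variable {N : ℕ}

theorem lintegral_comp_inv_smul (φ : Space N → ℝ≥0∞) {r : ℝ} (hr : 0 < r) :
    ∫⁻ x, φ (r⁻¹ • x) = ENNReal.ofReal (r ^ N) * ∫⁻ x, φ x := by
  have h := Measure.map_addHaar_smul (volume : Measure (Space N)) (inv_ne_zero hr.ne')
  have he : MeasurableEmbedding (fun x : Space N => r⁻¹ • x) :=
    (Homeomorph.smulOfNeZero r⁻¹ (inv_ne_zero hr.ne')).measurableEmbedding
  rw [← he.lintegral_map, h, lintegral_smul_measure]
  simp [abs_of_pos hr]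

/-- The set S of radii is left free so that balls (`Iio 1`) and their complements (`Ici 1`) are both
covered. -/
theorem lintegral_scaled_rpow {S : Set ℝ} (hS : MeasurableSet S) (s : ℝ) {r : ℝ} (hr : 0 < r) :
    ∫⁻ x : Space N, {x : Space N | r⁻¹ * ‖x‖ ∈ S}.indicator (fun x => ENNReal.ofReal (‖x‖ ^ s)) x
      = ENNReal.ofReal (r ^ (N + s)) *
        ∫⁻ x : Space N, {x : Space N | ‖x‖ ∈ S}.indicator (fun x => ENNReal.ofReal (‖x‖ ^ s)) x := by
  have h := lintegral_comp_inv_smul (N := N) (fun x => ENNReal.ofReal (r ^ s) *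
    {x : Space N | ‖x‖ ∈ S}.indicator (fun x => ENNReal.ofReal (‖x‖ ^ s)) x) hr
  have hm : Measurable ({x : Space N | ‖x‖ ∈ S}.indicator
      (fun x => ENNReal.ofReal (‖x‖ ^ s))) :=
    (by fun_prop : Measurable fun x : Space N => ENNReal.ofReal (‖x‖ ^ s)).indicator
      (measurable_norm hS)
  rw [lintegral_const_mul _ hm, ← mul_assoc, ← ENNReal.ofReal_mul (by positivity),
    ← Real.rpow_natCast r N, ← Real.rpow_add hr] at h
  rw [← h]
  refine lintegral_congr fun x => ?_
  have hn : ‖r⁻¹ • x‖ = r⁻¹ * ‖x‖ := by rw [norm_smul, Real.norm_of_nonneg (by positivity)]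
  classical
  simp only [Set.indicator_apply, Set.mem_ofPred_eq, hn]
  split_ifs
  · rw [← ENNReal.ofReal_mul (by positivity), ← Real.mul_rpow hr.le (by positivity),
      mul_inv_cancel_left₀ hr.ne']
  · simp

theorem lintegral_Iio_rpow_lt_top (hN : 0 < N) {s : ℝ} (hs : -(N : ℝ) < s) :
    ∫⁻ x : Space N, {x : Space N | ‖x‖ ∈ Set.Iio 1}.indicator
      (fun x => ENNReal.ofReal (‖x‖ ^ s)) x < ⊤ := by
  have hb : {x : Space N | ‖x‖ ∈ Set.Iio 1} = ball 0 1 := by ext; simp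
  rw [hb, lintegral_indicator measurableSet_ball]
  have h := integrableOn_ball_of_norm_le_rpow (E := Space N) (μ := volume) (r := 1) (C := 1)
    (α := -s) (f := fun x : Space N => ‖x‖ ^ s) (by simpa using Nat.succ_le_of_lt hN)
    (by simpa using by linarith)
    (Filter.Eventually.of_forall fun x => by
      rw [Real.norm_of_nonneg (by positivity), neg_neg, one_mul])
    (by fun_prop : Measurable fun x : Space N => ‖x‖ ^ s).aestronglyMeasurable
  exact h.lintegral_lt_top

theorem lintegral_Ici_rpow_lt_top {s : ℝ} (hs : s < -(N : ℝ)) :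
    ∫⁻ x : Space N, {x : Space N | ‖x‖ ∈ Set.Ici 1}.indicator
      (fun x => ENNReal.ofReal (‖x‖ ^ s)) x < ⊤ := by
  have h := integrable_one_add_norm (E := Space N) (μ := volume) (r := -s)
    (by simpa using by linarith)
  rw [neg_neg] at h
  refine lt_of_le_of_lt ?_ (h.const_mul ((2 : ℝ) ^ (-s))).lintegral_lt_top
  refine lintegral_mono fun x => ?_
  by_cases hx : ‖x‖ ∈ Set.Ici 1
  · rw [Set.indicator_of_mem (by exact hx)]
    refine ENNReal.ofReal_le_ofReal ?_
    have hx1 : 1 ≤ ‖x‖ := hx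
    have h1 : (2 * ‖x‖) ^ s ≤ (1 + ‖x‖) ^ s :=
      Real.rpow_le_rpow_of_nonpos (by positivity) (by linarith)
        (by have := Nat.cast_nonneg (α := ℝ) N; linarith)
    calc ‖x‖ ^ s = 2 ^ (-s) * (2 * ‖x‖) ^ s := by
          rw [Real.mul_rpow zero_le_two (norm_nonneg x), ← mul_assoc,
            ← Real.rpow_add two_pos, neg_add_cancel, Real.rpow_zero, one_mul]
      _ ≤ _ := by gcongr
  · rw [Set.indicator_of_notMem (by exact hx)]
    exact zero_le

theorem exists_lintegral_lt_rpow_le (hN : 0 < N) {s : ℝ} (hs : -(N : ℝ) < s) :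
    ∃ c : ℝ≥0∞, c ≠ ⊤ ∧ ∀ r : ℝ, 0 < r →
      ∫⁻ x : Space N, {x : Space N | ‖x‖ < r}.indicator (fun x => ENNReal.ofReal (‖x‖ ^ s)) x
        ≤ c * ENNReal.ofReal (r ^ (N + s)) := by
  refine ⟨_, (lintegral_Iio_rpow_lt_top hN hs).ne, fun r hr => ?_⟩
  rw [mul_comm, ← lintegral_scaled_rpow measurableSet_Iio s hr]
  have : ∀ x : Space N, r⁻¹ * ‖x‖ ∈ Set.Iio 1 ↔ ‖x‖ < r := fun x => by
    rw [Set.mem_Iio, inv_mul_lt_iff₀ hr, mul_one]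
  simp_rw [this]
  rfl

theorem exists_lintegral_ge_rpow_le {s : ℝ} (hs : s < -(N : ℝ)) :
    ∃ c : ℝ≥0∞, c ≠ ⊤ ∧ ∀ r : ℝ, 0 < r →
      ∫⁻ x : Space N, {x : Space N | r ≤ ‖x‖}.indicator (fun x => ENNReal.ofReal (‖x‖ ^ s)) x
        ≤ c * ENNReal.ofReal (r ^ (N + s)) := by
  refine ⟨_, (lintegral_Ici_rpow_lt_top hs).ne, fun r hr => ?_⟩
  rw [mul_comm, ← lintegral_scaled_rpow measurableSet_Ici s hr]
  have : ∀ x : Space N, r⁻¹ * ‖x‖ ∈ Set.Ici 1 ↔ r ≤ ‖x‖ := fun x => by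
    rw [Set.mem_Ici, le_inv_mul_iff₀ hr, mul_one]
  simp_rw [this]
  rfl

end Scaling

end Weights

/-! ### Uniform weighted bounds for the three model kernels. -/

section Kernels

variable {N : ℕ}

/-- The integrals `∫ k(x, y)^q |x|^β dx` are bounded uniformly in `y ≠ 0`. -/
def IsUniformlyBoundedKernel (q β : ℝ) (k : Space N → Space N → ℝ≥0∞) : Prop :=
  ∃ M : ℝ≥0∞, M ≠ ⊤ ∧ ∀ y, y ≠ 0 → ∫⁻ x, k x y ^ q * ENNReal.ofReal (‖x‖ ^ β) ≤ M

theorem IsUniformlyBoundedKernel.add {q β : ℝ} (hq : 1 ≤ q) {k₁ k₂ : Space N → Space N → ℝ≥0∞}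
    (h₁ : IsUniformlyBoundedKernel q β k₁) (h₂ : IsUniformlyBoundedKernel q β k₂)
    (hk₁ : Measurable (Function.uncurry k₁)) :
    IsUniformlyBoundedKernel q β (fun x y => k₁ x y + k₂ x y) := by
  obtain ⟨M₁, hM₁, h₁⟩ := h₁
  obtain ⟨M₂, hM₂, h₂⟩ := h₂
  refine ⟨2 ^ (q - 1) * (M₁ + M₂), ENNReal.mul_ne_top
    (ENNReal.rpow_ne_top_of_nonneg (by linarith) ENNReal.ofNat_ne_top)
    (ENNReal.add_ne_top.2 ⟨hM₁, hM₂⟩), fun y hy => ?_⟩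
  have hm : Measurable fun x => k₁ x y ^ q * ENNReal.ofReal (‖x‖ ^ β) :=
    (hk₁.of_uncurry_right.pow_const q).mul (by fun_prop)
  calc ∫⁻ x, (k₁ x y + k₂ x y) ^ q * ENNReal.ofReal (‖x‖ ^ β)
      ≤ ∫⁻ x, 2 ^ (q - 1) * (k₁ x y ^ q * ENNReal.ofReal (‖x‖ ^ β)
          + k₂ x y ^ q * ENNReal.ofReal (‖x‖ ^ β)) := by
        refine lintegral_mono fun x => ?_
        rw [← add_mul, ← mul_assoc]
        gcongr
        exact ENNReal.rpow_add_le_mul_rpow_add_rpow _ _ hq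
    _ ≤ _ := by
        rw [lintegral_const_mul' _ _
          (ENNReal.rpow_ne_top_of_nonneg (by linarith) ENNReal.ofNat_ne_top),
          lintegral_add_left hm]
        gcongr
        · exact h₁ y hy
        · exact h₂ y hy

/-- Scale invariance: the opposite powers of t = ‖y‖ cancel, so the bounds below do not depend on y.
-/
theorem mul_rpow_mul_rpow_neg {b d t : ℝ} (hb : 0 < b) (hd : 0 < d) (ht : 0 < t) (p : ℝ) :
    (b * t) ^ p * (d * t) ^ (-p) = (b / d) ^ p := by
  rw [Real.rpow_neg (by positivity), ← div_eq_mul_inv, ← Real.div_rpow (by positivity)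
    (by positivity), mul_div_mul_right _ _ ht.ne']

/-- The region `‖x‖ < 2‖y‖`. -/
def nearRegion (y : Space N) : Set (Space N) := {x | ‖x‖ < 2 * ‖y‖}

/-- The kernel `|x - y|^s` on the region `‖x‖ < 2‖y‖`. -/
def rieszKernel (s : ℝ) (x y : Space N) : ℝ≥0∞ :=
  (nearRegion y).indicator (fun x => ENNReal.ofReal (‖x - y‖ ^ s)) x

/-- The kernel `|x|^(s+1) / |y|` on the region `‖x‖ < 2‖y‖`. -/
def innerKernel (s : ℝ) (x y : Space N) : ℝ≥0∞ :=
  (nearRegion y).indicator (fun x => ENNReal.ofReal (‖x‖ ^ (s + 1) * ‖y‖⁻¹)) x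

/-- The kernel `|x|^(s-1) |y|` on the region `2‖y‖ ≤ ‖x‖`. -/
def outerKernel (s : ℝ) (x y : Space N) : ℝ≥0∞ :=
  (nearRegion y)ᶜ.indicator (fun x => ENNReal.ofReal (‖x‖ ^ (s - 1) * ‖y‖)) x

theorem measurableSet_setOf_mem_nearRegion :
    MeasurableSet {p : Space N × Space N | p.1 ∈ nearRegion p.2} :=
  measurableSet_lt (f := fun p : Space N × Space N => ‖p.1‖) (g := fun p => 2 * ‖p.2‖)
    (by fun_prop) (by fun_prop)

theorem measurable_rieszKernel (s : ℝ) :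
    Measurable (Function.uncurry (rieszKernel (N := N) s)) :=
  (by fun_prop : Measurable fun p : Space N × Space N =>
    ENNReal.ofReal (‖p.1 - p.2‖ ^ s)).indicator measurableSet_setOf_mem_nearRegion

theorem measurable_innerKernel (s : ℝ) :
    Measurable (Function.uncurry (innerKernel (N := N) s)) :=
  (by fun_prop : Measurable fun p : Space N × Space N =>
    ENNReal.ofReal (‖p.1‖ ^ (s + 1) * ‖p.2‖⁻¹)).indicator measurableSet_setOf_mem_nearRegion

theorem measurable_outerKernel (s : ℝ) :
    Measurable (Function.uncurry (outerKernel (N := N) s)) :=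
  (by fun_prop : Measurable fun p : Space N × Space N =>
    ENNReal.ofReal (‖p.1‖ ^ (s - 1) * ‖p.2‖)).indicator
      measurableSet_setOf_mem_nearRegion.compl

theorem indicator_rpow_mul {S : Set (Space N)} {φ : Space N → ℝ} (hφ : ∀ x, 0 ≤ φ x) {q : ℝ}
    (hq : 0 < q) (β : ℝ) (x : Space N) :
    (S.indicator (fun x => ENNReal.ofReal (φ x)) x) ^ q * ENNReal.ofReal (‖x‖ ^ β)
      = S.indicator (fun x => ENNReal.ofReal (φ x ^ q * ‖x‖ ^ β)) x := by
  by_cases hx : x ∈ S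
  · rw [Set.indicator_of_mem hx, Set.indicator_of_mem hx,
      ENNReal.ofReal_rpow_of_nonneg (hφ x) hq.le,
      ← ENNReal.ofReal_mul (Real.rpow_nonneg (hφ x) q)]
  · rw [Set.indicator_of_notMem hx, Set.indicator_of_notMem hx, ENNReal.zero_rpow_of_pos hq,
      zero_mul]

/-- The integrand is |x|^(q-N)|y|^(-q), and q - N > -N makes it integrable on |x| < 2|y|. -/
theorem isUniformlyBoundedKernel_innerKernel (hN : 0 < N) {s q : ℝ} (hq : 1 ≤ q)
    (hs : -(N : ℝ) - s * q ≠ 0) :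
    IsUniformlyBoundedKernel (N := N) q (-N - s * q) (innerKernel s) := by
  have hq0 : 0 < q := by linarith
  obtain ⟨c, hc, h⟩ := exists_lintegral_lt_rpow_le hN (s := q - N) (by linarith)
  refine ⟨c * ENNReal.ofReal ((2 / 1) ^ q), ENNReal.mul_ne_top hc ENNReal.ofReal_ne_top,
    fun y hy => ?_⟩
  have hy0 : 0 < ‖y‖ := norm_pos_iff.2 hy
  calc ∫⁻ x, innerKernel s x y ^ q * ENNReal.ofReal (‖x‖ ^ (-(N : ℝ) - s * q))
      ≤ ∫⁻ x, (nearRegion y).indicator (fun x => ENNReal.ofReal (‖x‖ ^ (q - N))) x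
          * ENNReal.ofReal ((1 * ‖y‖) ^ (-q)) := by
        refine lintegral_mono fun x => ?_
        rw [innerKernel, indicator_rpow_mul (fun x => by positivity) hq0]
        by_cases hx : x ∈ nearRegion y
        · rw [Set.indicator_of_mem hx, Set.indicator_of_mem hx,
            ← ENNReal.ofReal_mul (by positivity)]
          refine ENNReal.ofReal_le_ofReal ?_
          -- At x = 0 the weight is `0 ^ β` with β ≠ 0, which is 0 by convention even for β < 0.
          rcases eq_or_ne x 0 with rfl | hx0
          · rw [norm_zero, Real.zero_rpow hs, mul_zero]
            positivity
          · have hx1 : 0 < ‖x‖ := norm_pos_iff.2 hx0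
            rw [Real.mul_rpow (by positivity) (by positivity), ← Real.rpow_mul hx1.le,
              Real.inv_rpow hy0.le, ← Real.rpow_neg hy0.le, mul_right_comm, ← Real.rpow_add hx1,
              one_mul]
            apply le_of_eq
            congr 2
            ring
        · rw [Set.indicator_of_notMem hx]
          exact zero_le
    _ = (∫⁻ x, (nearRegion y).indicator (fun x => ENNReal.ofReal (‖x‖ ^ (q - N))) x)
          * ENNReal.ofReal ((1 * ‖y‖) ^ (-q)) := lintegral_mul_const' _ _ ENNReal.ofReal_ne_top
    _ ≤ c * ENNReal.ofReal ((2 * ‖y‖) ^ (N + (q - N))) * ENNReal.ofReal ((1 * ‖y‖) ^ (-q)) := by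
        gcongr
        exact h _ (by positivity)
    _ = _ := by
        rw [mul_assoc, ← ENNReal.ofReal_mul (by positivity), add_sub_cancel,
          mul_rpow_mul_rpow_neg two_pos one_pos hy0]

/-- The integrand is |x|^(-q-N)|y|^q, integrable at infinity: this is where the gained power |y|/|x|
is needed. -/
theorem isUniformlyBoundedKernel_outerKernel {s q : ℝ} (hq : 1 ≤ q) :
    IsUniformlyBoundedKernel (N := N) q (-N - s * q) (outerKernel s) := by
  have hq0 : 0 < q := by linarith
  obtain ⟨c, hc, h⟩ := exists_lintegral_ge_rpow_le (N := N) (s := -q - N) (by linarith)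
  refine ⟨c * ENNReal.ofReal ((2 / 1) ^ (-q)), ENNReal.mul_ne_top hc ENNReal.ofReal_ne_top,
    fun y hy => ?_⟩
  have hy0 : 0 < ‖y‖ := norm_pos_iff.2 hy
  have hS : (nearRegion y)ᶜ = {x | 2 * ‖y‖ ≤ ‖x‖} := by ext x; simp [nearRegion]
  calc ∫⁻ x, outerKernel s x y ^ q * ENNReal.ofReal (‖x‖ ^ (-(N : ℝ) - s * q))
      ≤ ∫⁻ x, {x | 2 * ‖y‖ ≤ ‖x‖}.indicator (fun x => ENNReal.ofReal (‖x‖ ^ (-q - N))) x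
          * ENNReal.ofReal ((1 * ‖y‖) ^ (-(-q))) := by
        refine lintegral_mono fun x => ?_
        rw [outerKernel, indicator_rpow_mul (fun x => by positivity) hq0, hS]
        by_cases hx : x ∈ {x | 2 * ‖y‖ ≤ ‖x‖}
        · rw [Set.indicator_of_mem hx, Set.indicator_of_mem hx,
            ← ENNReal.ofReal_mul (Real.rpow_nonneg (norm_nonneg x) _)]
          refine ENNReal.ofReal_le_ofReal ?_
          have hx1 : 0 < ‖x‖ := (by positivity : 0 < 2 * ‖y‖).trans_le hx
          rw [Real.mul_rpow (by positivity) (by positivity), ← Real.rpow_mul hx1.le,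
            mul_right_comm, ← Real.rpow_add hx1, one_mul, neg_neg]
          apply le_of_eq
          congr 2
          ring
        · rw [Set.indicator_of_notMem hx]
          exact zero_le
    _ = (∫⁻ x, {x | 2 * ‖y‖ ≤ ‖x‖}.indicator (fun x => ENNReal.ofReal (‖x‖ ^ (-q - N))) x)
          * ENNReal.ofReal ((1 * ‖y‖) ^ (-(-q))) :=
        lintegral_mul_const' _ _ ENNReal.ofReal_ne_top
    _ ≤ c * ENNReal.ofReal ((2 * ‖y‖) ^ (N + (-q - N)))
          * ENNReal.ofReal ((1 * ‖y‖) ^ (-(-q))) := by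
        gcongr
        exact h _ (by positivity)
    _ = _ := by
        rw [mul_assoc, ← ENNReal.ofReal_mul (by positivity), add_sub_cancel,
          mul_rpow_mul_rpow_neg two_pos one_pos hy0]

/-- Split at |x| = |y|/2. Above, the weight is at most its value at |y|/2, and |x-y|^(sq) is
integrable on |x-y| < 3|y| since sq > -N. Below, |x-y| ≥ |y|/2, and the weight is integrable near 0
since s < 0. -/
theorem isUniformlyBoundedKernel_rieszKernel (hN : 0 < N) {s q : ℝ} (hq : 1 ≤ q)
    (hs : s < 0) (hsq : -(N : ℝ) < s * q) :
    IsUniformlyBoundedKernel (N := N) q (-N - s * q) (rieszKernel s) := by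
  have hq0 : 0 < q := by linarith
  have hsq0 : s * q < 0 := mul_neg_of_neg_of_pos hs hq0
  obtain ⟨c₁, hc₁, h₁⟩ := exists_lintegral_lt_rpow_le hN (s := s * q) hsq
  obtain ⟨c₂, hc₂, h₂⟩ := exists_lintegral_lt_rpow_le hN (s := -N - s * q) (by linarith)
  refine ⟨c₁ * ENNReal.ofReal ((3 / 2⁻¹) ^ (N + s * q))
    + c₂ * ENNReal.ofReal ((2 / 2⁻¹) ^ (-(s * q))), ENNReal.add_ne_top.2
    ⟨ENNReal.mul_ne_top hc₁ ENNReal.ofReal_ne_top, ENNReal.mul_ne_top hc₂ ENNReal.ofReal_ne_top⟩,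
    fun y hy => ?_⟩
  have hy0 : 0 < ‖y‖ := norm_pos_iff.2 hy
  let φ : Space N → ℝ≥0∞ := {x | ‖x‖ < 3 * ‖y‖}.indicator
    (fun x => ENNReal.ofReal (‖x‖ ^ (s * q)))
  have hφ : Measurable φ := (by fun_prop : Measurable fun x : Space N =>
    ENNReal.ofReal (‖x‖ ^ (s * q))).indicator (measurableSet_lt (by fun_prop) (by fun_prop))
  let ψ : Space N → ℝ≥0∞ := (nearRegion y).indicator
    (fun x => ENNReal.ofReal (‖x‖ ^ (-N - s * q)))
  calc ∫⁻ x, rieszKernel s x y ^ q * ENNReal.ofReal (‖x‖ ^ (-(N : ℝ) - s * q))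
      ≤ ∫⁻ x, (φ (x - y) * ENNReal.ofReal ((2⁻¹ * ‖y‖) ^ (-(N + s * q)))
          + ψ x * ENNReal.ofReal ((2⁻¹ * ‖y‖) ^ (-(-(s * q))))) := by
        refine lintegral_mono fun x => ?_
        rw [rieszKernel, indicator_rpow_mul (fun x => by positivity) hq0]
        by_cases hx : x ∈ nearRegion y
        · have hx2 : ‖x‖ < 2 * ‖y‖ := hx
          rw [Set.indicator_of_mem hx, ← Real.rpow_mul (norm_nonneg _)]
          rcases le_total (2⁻¹ * ‖y‖) ‖x‖ with hxy | hxy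
          · refine le_add_right ?_
            have hmem : x - y ∈ {x | ‖x‖ < 3 * ‖y‖} :=
              (norm_sub_le x y).trans_lt (by linarith)
            simp only [φ]
            rw [Set.indicator_of_mem hmem, ← ENNReal.ofReal_mul (by positivity)]
            refine ENNReal.ofReal_le_ofReal ?_
            gcongr ?_ * ?_
            rw [neg_add']
            exact Real.rpow_le_rpow_of_nonpos (by positivity) hxy (by linarith)
          · refine le_add_left ?_
            simp only [ψ]
            rw [Set.indicator_of_mem hx, ← ENNReal.ofReal_mul (by positivity), mul_comm]
            refine ENNReal.ofReal_le_ofReal ?_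
            gcongr ?_ * ?_
            rw [neg_neg]
            refine Real.rpow_le_rpow_of_nonpos (by positivity) ?_ hsq0.le
            have := norm_sub_norm_le y x
            rw [norm_sub_rev] at this
            linarith
        · rw [Set.indicator_of_notMem hx]
          exact zero_le
    _ = (∫⁻ x, φ x) * ENNReal.ofReal ((2⁻¹ * ‖y‖) ^ (-(N + s * q)))
          + (∫⁻ x, ψ x) * ENNReal.ofReal ((2⁻¹ * ‖y‖) ^ (-(-(s * q)))) := by
        have hm : Measurable fun x => φ (x - y) * ENNReal.ofReal ((2⁻¹ * ‖y‖) ^ (-(N + s * q))) :=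
          (hφ.comp (measurable_id.sub_const y)).mul_const _
        rw [lintegral_add_left hm, lintegral_mul_const' _ _ ENNReal.ofReal_ne_top,
          lintegral_mul_const' _ _ ENNReal.ofReal_ne_top, lintegral_sub_right_eq_self φ y]
    _ ≤ c₁ * ENNReal.ofReal ((3 * ‖y‖) ^ (N + s * q))
            * ENNReal.ofReal ((2⁻¹ * ‖y‖) ^ (-(N + s * q)))
          + c₂ * ENNReal.ofReal ((2 * ‖y‖) ^ (N + (-N - s * q)))
            * ENNReal.ofReal ((2⁻¹ * ‖y‖) ^ (-(-(s * q)))) := by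
        gcongr
        · exact h₁ _ (by positivity)
        · exact h₂ _ (by positivity)
    _ = _ := by
        have : (N : ℝ) + (-N - s * q) = -(s * q) := by ring
        rw [this, mul_assoc, mul_assoc, ← ENNReal.ofReal_mul (by positivity),
          ← ENNReal.ofReal_mul (by positivity),
          mul_rpow_mul_rpow_neg three_pos (by norm_num) hy0,
          mul_rpow_mul_rpow_neg two_pos (by norm_num) hy0]

/-- The majorant of a kernel of homogeneity `s` after subtraction of its moment. -/
def majorant (s : ℝ) (x y : Space N) : ℝ≥0∞ :=
  rieszKernel s x y + innerKernel s x y + outerKernel s x y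

theorem measurable_majorant (s : ℝ) : Measurable (Function.uncurry (majorant (N := N) s)) :=
  ((measurable_rieszKernel s).add (measurable_innerKernel s)).add (measurable_outerKernel s)

theorem isUniformlyBoundedKernel_majorant (hN : 0 < N) {s q : ℝ} (hq : 1 ≤ q)
    (hs : s < 0) (hsq : -(N : ℝ) < s * q) :
    IsUniformlyBoundedKernel (N := N) q (-N - s * q) (majorant s) :=
  ((isUniformlyBoundedKernel_rieszKernel hN hq hs hsq).add hq
    (isUniformlyBoundedKernel_innerKernel hN hq (by linarith)) (measurable_rieszKernel s)).add hq
    (isUniformlyBoundedKernel_outerKernel hq)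
    ((measurable_rieszKernel s).add (measurable_innerKernel s))

end Kernels

/-! ### Pointwise bound for the corrected kernel, and absolute convergence. -/

section Estimates

variable {N : ℕ} {F V : Type*} [NormedAddCommGroup F] [NormedSpace ℂ F]
  [NormedAddCommGroup V] [NormedSpace ℂ V]

/-- Mean value inequality on the ball of radius ‖y‖ about 0, all of whose points are at distance at
least ‖x‖/2 from x. -/
theorem norm_sub_apply_zero_le {G : Type*} [NormedAddCommGroup G] [NormedSpace ℝ G]
    {k : Space N → G} {x y : Space N} {C s : ℝ} (hC : 0 ≤ C) (hs : s ≤ 1)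
    (hd : ∀ z, x ≠ z → DifferentiableAt ℝ k z)
    (hk : ∀ z, x ≠ z → ‖fderiv ℝ k z‖ ≤ C * ‖x - z‖ ^ (s - 1))
    (hx : x ≠ 0) (hxy : 2 * ‖y‖ ≤ ‖x‖) :
    ‖k y - k 0‖ ≤ C * 2 ^ (1 - s) * (‖x‖ ^ (s - 1) * ‖y‖) := by
  have hx0 : 0 < ‖x‖ := norm_pos_iff.2 hx
  have hdist : ∀ z ∈ Metric.closedBall (0 : Space N) ‖y‖, 2⁻¹ * ‖x‖ ≤ ‖x - z‖ := by
    intro z hz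
    have hz' : ‖z‖ ≤ ‖y‖ := by simpa using hz
    have := norm_sub_norm_le x z
    linarith
  have hne : ∀ z ∈ Metric.closedBall (0 : Space N) ‖y‖, x ≠ z := by
    rintro z hz rfl
    have := hdist _ hz
    rw [sub_self, norm_zero] at this
    linarith
  have h := Convex.norm_image_sub_le_of_norm_fderiv_le (𝕜 := ℝ) (f := k)
    (C := C * (2⁻¹ * ‖x‖) ^ (s - 1)) (s := Metric.closedBall (0 : Space N) ‖y‖) (x := 0) (y := y)
    (fun z hz => hd z (hne z hz))
    (fun z hz => (hk z (hne z hz)).trans (mul_le_mul_of_nonneg_left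
      (Real.rpow_le_rpow_of_nonpos (by positivity) (hdist z hz) (by linarith)) hC))
    (convex_closedBall _ _) (by simp) (by simp)
  refine h.trans_eq ?_
  rw [sub_zero, Real.mul_rpow (by norm_num) hx0.le, Real.inv_rpow zero_le_two,
    ← Real.rpow_neg zero_le_two, neg_sub]
  ring

theorem enorm_sub_comp_le_majorant {K : Space N → F →L[ℂ] V} {g : Space N → F →L[ℂ] F}
    {x y : Space N} {C c s : ℝ} (hC : 0 ≤ C) (hc : 0 ≤ c) (hs : s ≤ 1)
    (hK : ∀ z, x ≠ z → ‖K z‖ ≤ C * ‖x - z‖ ^ s)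
    (hd : ∀ z, x ≠ z → DifferentiableAt ℝ K z)
    (hK' : ∀ z, x ≠ z → ‖fderiv ℝ K z‖ ≤ C * ‖x - z‖ ^ (s - 1))
    (hg0 : ∀ z, ‖g z - ContinuousLinearMap.id ℂ F‖ ≤ c * ‖z‖) (hg1 : ∀ z, ‖z‖ * ‖g z‖ ≤ c)
    (hx : x ≠ 0) (hxy : x ≠ y) :
    ‖K y - K 0 ∘L g (‖x‖⁻¹ • y)‖ₑ
      ≤ ENNReal.ofReal (C * (2 ^ (1 - s) + c + 1)) * majorant s x y := by
  have hx0 : 0 < ‖x‖ := norm_pos_iff.2 hx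
  have hn : ‖‖x‖⁻¹ • y‖ = ‖x‖⁻¹ * ‖y‖ := by rw [norm_smul, norm_inv, norm_norm]
  have hK0 : ‖K 0‖ ≤ C * ‖x‖ ^ s := by simpa using hK 0 hx
  have h2 : (0 : ℝ) ≤ 2 ^ (1 - s) := by positivity
  rw [← ofReal_norm]
  by_cases hy : x ∈ nearRegion y
  · have hy2 : ‖x‖ < 2 * ‖y‖ := hy
    have hy0 : 0 < ‖y‖ := by linarith
    rw [majorant, rieszKernel, innerKernel, outerKernel, Set.indicator_of_mem hy,
      Set.indicator_of_mem hy, Set.indicator_of_notMem (by simpa using hy), add_zero,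
      ← ENNReal.ofReal_add (by positivity) (by positivity), ← ENNReal.ofReal_mul (by positivity)]
    refine ENNReal.ofReal_le_ofReal ?_
    -- Decay of g at y/‖x‖ yields the factor ‖x‖/‖y‖.
    have hgy : ‖g (‖x‖⁻¹ • y)‖ ≤ c * (‖x‖ * ‖y‖⁻¹) := by
      have := hg1 (‖x‖⁻¹ • y)
      rw [hn] at this
      calc ‖g (‖x‖⁻¹ • y)‖ = (‖x‖⁻¹ * ‖y‖ * ‖g (‖x‖⁻¹ • y)‖) * (‖x‖ * ‖y‖⁻¹) := by
            field_simp
        _ ≤ _ := by gcongr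
    calc ‖K y - K 0 ∘L g (‖x‖⁻¹ • y)‖
        ≤ ‖K y‖ + ‖K 0‖ * ‖g (‖x‖⁻¹ • y)‖ := (norm_sub_le _ _).trans
          (by gcongr; exact ContinuousLinearMap.opNorm_comp_le _ _)
      _ ≤ C * ‖x - y‖ ^ s + (C * ‖x‖ ^ s) * (c * (‖x‖ * ‖y‖⁻¹)) := by
          gcongr
          exact hK y hxy
      _ = C * 1 * ‖x - y‖ ^ s + C * c * (‖x‖ ^ (s + 1) * ‖y‖⁻¹) := by
          rw [Real.rpow_add_one hx0.ne']
          ring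
      _ ≤ C * (2 ^ (1 - s) + c + 1) * ‖x - y‖ ^ s
          + C * (2 ^ (1 - s) + c + 1) * (‖x‖ ^ (s + 1) * ‖y‖⁻¹) := by
          gcongr <;> linarith
      _ = _ := by ring
  · have hy2 : 2 * ‖y‖ ≤ ‖x‖ := not_lt.1 hy
    rw [majorant, rieszKernel, innerKernel, outerKernel, Set.indicator_of_notMem hy,
      Set.indicator_of_notMem hy, Set.indicator_of_mem (by exact hy), zero_add, zero_add,
      ← ENNReal.ofReal_mul (by positivity)]
    refine ENNReal.ofReal_le_ofReal ?_
    -- Since g is close to id near 0, both differences are small: the first by smoothness of K, the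
    -- second by the Lipschitz bound on g.
    have hsplit : K y - K 0 ∘L g (‖x‖⁻¹ • y)
        = (K y - K 0) - K 0 ∘L (g (‖x‖⁻¹ • y) - ContinuousLinearMap.id ℂ F) := by
      rw [ContinuousLinearMap.comp_sub, ContinuousLinearMap.comp_id]
      abel
    rw [hsplit]
    calc ‖(K y - K 0) - K 0 ∘L (g (‖x‖⁻¹ • y) - ContinuousLinearMap.id ℂ F)‖
        ≤ ‖K y - K 0‖ + ‖K 0‖ * ‖g (‖x‖⁻¹ • y) - ContinuousLinearMap.id ℂ F‖ :=
          (norm_sub_le _ _).trans (by gcongr; exact ContinuousLinearMap.opNorm_comp_le _ _)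
      _ ≤ C * 2 ^ (1 - s) * (‖x‖ ^ (s - 1) * ‖y‖) + (C * ‖x‖ ^ s) * (c * (‖x‖⁻¹ * ‖y‖)) := by
          gcongr
          · exact norm_sub_apply_zero_le hC hs hd hK' hx hy2
          · exact hn ▸ hg0 _
      _ = C * (2 ^ (1 - s) + c) * (‖x‖ ^ (s - 1) * ‖y‖) := by
          rw [Real.rpow_sub_one hx0.ne']
          field_simp
      _ ≤ _ := mul_le_mul_of_nonneg_right (mul_le_mul_of_nonneg_left (by linarith) hC)
          (by positivity)

/-- A kernel with an integrable singularity at `x` is integrable against bounded functions of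
compact support. -/
theorem integrable_apply_of_norm_le_rpow (hN : 0 < N) {K : Space N → F →L[ℂ] V} {x : Space N}
    {C s : ℝ} (hs : -(N : ℝ) < s) (hK : ∀ z, x ≠ z → ‖K z‖ ≤ C * ‖x - z‖ ^ s)
    (hd : ∀ z, x ≠ z → DifferentiableAt ℝ K z) {f : Space N → F} (hf : Continuous f)
    (hfc : HasCompactSupport f) : Integrable (fun y => K y (f y)) := by
  have : Nonempty (Fin N) := ⟨⟨0, hN⟩⟩
  have hne : ∀ᵐ y : Space N, x ≠ y := by
    have : Nontrivial (Space N) := Module.nontrivial_of_finrank_pos (R := ℝ) (by simpa using hN)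
    filter_upwards [compl_mem_ae_iff.2 (measure_singleton x)] with y hy using Ne.symm hy
  -- K is differentiable, hence continuous, off the null set {x}.
  have hKm : AEStronglyMeasurable K := by
    have hc : ContinuousOn K {x}ᶜ := fun z hz =>
      (hd z (Ne.symm hz)).continuousAt.continuousWithinAt
    have := hc.aestronglyMeasurable (μ := volume) (measurableSet_singleton x).compl
    rwa [restrict_compl_singleton] at this
  have hloc : LocallyIntegrable (fun y : Space N => ‖y‖ ^ s) :=
    locallyIntegrable_of_norm_le_rpow (C := 1) (α := -s) (by simpa using Nat.succ_le_of_lt hN)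
      (by simpa using by linarith)
      (Filter.Eventually.of_forall fun x => by
        rw [Real.norm_of_nonneg (by positivity), neg_neg, one_mul])
      (by fun_prop : Measurable fun x : Space N => ‖x‖ ^ s).aestronglyMeasurable
  obtain ⟨B, hB⟩ := hf.bounded_above_of_compact_support hfc
  have hS : IsCompact ((fun y => y - x) '' tsupport f) :=
    IsCompact.image hfc (by fun_prop)
  have hI := (integrable_indicator_iff hS.measurableSet).2 (hloc.integrableOn_isCompact hS)
  have hI' := ((hI.comp_sub_right x).const_mul (|C| * B))
  refine hI'.mono' ((show Continuous (Function.uncurry fun (T : F →L[ℂ] V) (z : F) => T z) from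
    isBoundedBilinearMap_apply.continuous).comp_aestronglyMeasurable₂ hKm
      hf.aestronglyMeasurable) ?_
  filter_upwards [hne] with y hy
  by_cases hys : y ∈ tsupport f
  · rw [Set.indicator_of_mem (Set.mem_image_of_mem _ hys)]
    calc ‖K y (f y)‖ ≤ ‖K y‖ * ‖f y‖ := (K y).le_opNorm _
      _ ≤ (|C| * ‖x - y‖ ^ s) * B := by
        gcongr
        · exact (hK y hy).trans (by gcongr; exact le_abs_self C)
        · exact hB y
      _ = _ := by rw [norm_sub_rev]; ring
  · rw [image_eq_zero_of_notMem_tsupport hys, map_zero, norm_zero]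
    have : 0 ≤ B := (norm_nonneg _).trans (hB 0)
    exact mul_nonneg (by positivity) (Set.indicator_nonneg (fun _ _ => by positivity) _)

end Estimates

/-! ### The weighted estimate and the final statement. -/

section Main

theorem lintegral_enorm_integral_rpow_le {N : ℕ} {F V : Type*} [NormedAddCommGroup F]
    [NormedSpace ℂ F] [CompleteSpace F] [NormedAddCommGroup V] [NormedSpace ℂ V] [CompleteSpace V]
    (hN : 0 < N) {C c s q : ℝ} {M : ℝ≥0∞} (hC : 0 ≤ C) (hc : 0 ≤ c) (hq : 1 ≤ q) (hs0 : s < 0)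
    (hsN : -(N : ℝ) < s)
    (hM : ∀ y : Space N, y ≠ 0 →
      ∫⁻ x, majorant s x y ^ q * ENNReal.ofReal (‖x‖ ^ (-N - s * q)) ≤ M)
    {K : Space N → Space N → (F →L[ℂ] V)}
    (hK : ∀ x y, x ≠ y → ‖K x y‖ ≤ C * ‖x - y‖ ^ s)
    (hKdiff : ∀ x y, x ≠ y → DifferentiableAt ℝ (K x) y)
    (hK' : ∀ x y, x ≠ y → ‖fderiv ℝ (K x) y‖ ≤ C * ‖x - y‖ ^ (s - 1))
    {g : Space N → F →L[ℂ] F} (hg : Continuous g)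
    (hg0 : ∀ z, ‖g z - ContinuousLinearMap.id ℂ F‖ ≤ c * ‖z‖) (hg1 : ∀ z, ‖z‖ * ‖g z‖ ≤ c)
    {f : Space N → F} (hf : Continuous f) (hfc : HasCompactSupport f)
    (hgf : ∀ r : ℝ, ∫ y, g (r • y) (f y) = 0) :
    ∫⁻ x, ‖∫ y, K x y (f y)‖ₑ ^ q * ENNReal.ofReal (‖x‖ ^ (-N - s * q))
      ≤ ENNReal.ofReal (C * (2 ^ (1 - s) + c + 1)) ^ q * M * (∫⁻ y, ‖f y‖ₑ) ^ q := by
  have hq0 : 0 < q := by linarith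
  set D := ENNReal.ofReal (C * (2 ^ (1 - s) + c + 1))
  have hnt : Nontrivial (Space N) := Module.nontrivial_of_finrank_pos (R := ℝ) (by simpa using hN)
  have hne : ∀ x : Space N, ∀ᵐ y : Space N, y ≠ x := fun x =>
    compl_mem_ae_iff.2 (measure_singleton x)
  have hpt : ∀ x : Space N, x ≠ 0 →
      ‖∫ y, K x y (f y)‖ₑ ≤ D * ∫⁻ y, majorant s x y * ‖f y‖ₑ := by
    intro x hx
    have hI1 := integrable_apply_of_norm_le_rpow hN hsN (hK x) (hKdiff x) hf hfc
    have hgc : Continuous fun y => g (‖x‖⁻¹ • y) (f y) := by fun_prop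
    have hgs : HasCompactSupport fun y => g (‖x‖⁻¹ • y) (f y) := by
      refine hfc.mono fun y hy h => hy ?_
      simp [h]
    have hgI : Integrable fun y => g (‖x‖⁻¹ • y) (f y) := hgc.integrable_of_hasCompactSupport hgs
    have hI2 : Integrable fun y => K x 0 (g (‖x‖⁻¹ • y) (f y)) := (K x 0).integrable_comp hgI
    -- Vanishing moment at scale r = ‖x‖⁻¹: the correction term contributes nothing.
    have h0 : ∫ y, K x 0 (g (‖x‖⁻¹ • y) (f y)) = 0 := by
      rw [ContinuousLinearMap.integral_comp_comm _ hgI, hgf, map_zero]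
    have heq : ∫ y, K x y (f y) = ∫ y, (K x y - K x 0 ∘L g (‖x‖⁻¹ • y)) (f y) := by
      simp only [sub_apply, ContinuousLinearMap.comp_apply]
      rw [integral_sub hI1 hI2, h0, sub_zero]
    rw [heq, ← lintegral_const_mul' _ _ ENNReal.ofReal_ne_top]
    refine (enorm_integral_le_lintegral_enorm _).trans (lintegral_mono_ae ?_)
    filter_upwards [hne x] with y hy
    refine (ContinuousLinearMap.le_opENorm _ _).trans ?_
    rw [← mul_assoc]
    gcongr
    exact enorm_sub_comp_le_majorant hC hc (by linarith) (hK x) (hKdiff x) (hK' x) hg0 hg1 hx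
      (Ne.symm hy)
  calc ∫⁻ x, ‖∫ y, K x y (f y)‖ₑ ^ q * ENNReal.ofReal (‖x‖ ^ (-N - s * q))
      ≤ ∫⁻ x, D ^ q * ((∫⁻ y, majorant s x y * ‖f y‖ₑ) ^ q
          * ENNReal.ofReal (‖x‖ ^ (-N - s * q))) := by
        refine lintegral_mono_ae ?_
        filter_upwards [hne 0] with x hx
        rw [← mul_assoc, ← ENNReal.mul_rpow_of_nonneg _ _ hq0.le]
        gcongr
        exact hpt x hx
    _ = D ^ q * ∫⁻ x, (∫⁻ y, majorant s x y * ‖f y‖ₑ) ^ q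
          * ENNReal.ofReal (‖x‖ ^ (-N - s * q)) :=
        lintegral_const_mul' _ _ (ENNReal.rpow_ne_top_of_nonneg hq0.le ENNReal.ofReal_ne_top)
    _ ≤ D ^ q * (M * (∫⁻ y, ‖f y‖ₑ) ^ q) := by
        gcongr
        refine lintegral_lintegral_rpow_le hq (measurable_majorant s) (by fun_prop)
          hf.enorm.measurable ?_
        filter_upwards [hne 0] with y hy using hM y hy
    _ = _ := by rw [mul_assoc]

end Main

end HardySobolev

end

theorem lemma2p1 {N ν : ℕ} {E F V : Type*}
    [NormedAddCommGroup E] [NormedSpace ℂ E] [FiniteDimensional ℂ E]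
    [NormedAddCommGroup F] [NormedSpace ℂ F] [FiniteDimensional ℂ F]
    [NormedAddCommGroup V] [NormedSpace ℂ V] [FiniteDimensional ℂ V]
    (A : HardySobolev.HomDiffOp N ν E F) (hell : A.IsElliptic) (hcan : A.IsCanceling)
    (l q : ℝ) (hl0 : 0 < l) (hlN : l < N) (hlν : l ≤ ν)
    (hq1 : 1 ≤ q) (hq : q < N / (N - l))
    (K : HardySobolev.Space N → HardySobolev.Space N → (F →L[ℂ] V))
    (hKint : LocallyIntegrable
      (fun p : HardySobolev.Space N × HardySobolev.Space N => K p.1 p.2) volume)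
    (C : ℝ)
    (hK : ∀ x y, x ≠ y → ‖K x y‖ ≤ C * ‖x - y‖ ^ (l - N))
    (hKdiff : ∀ x y, x ≠ y → DifferentiableAt ℝ (K x) y)
    (hK' : ∀ x y, x ≠ y → ‖fderiv ℝ (K x) y‖ ≤ C * ‖x - y‖ ^ (l - N - 1)) :
    ∃ C' : ℝ, 0 < C' ∧ ∀ u : HardySobolev.Space N → E, ContDiff ℝ ∞ u → HasCompactSupport u →
      (∀ x, Integrable (fun y => K x y (A.apply u y))) ∧
      Integrable (fun x => ‖∫ y, K x y (A.apply u y)‖ ^ q * ‖x‖ ^ (-(N : ℝ) + (N - l) * q)) ∧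
      (∫ x, ‖∫ y, K x y (A.apply u y)‖ ^ q * ‖x‖ ^ (-(N : ℝ) + (N - l) * q)) ^ (1 / q)
        ≤ C' * ∫ x, ‖A.apply u x‖ := by
  have : CompleteSpace F := FiniteDimensional.complete ℂ F
  have : CompleteSpace V := FiniteDimensional.complete ℂ V
  have hN : 0 < N := by exact_mod_cast hl0.trans hlN
  have hq0 : 0 < q := by linarith
  have hs0 : l - N < 0 := by linarith
  have hsN : -(N : ℝ) < l - N := by linarith
  -- This is q < N/(N-ℓ), the integrability of |x-y|^((ℓ-N)q) at the diagonal.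
  have hsq : -(N : ℝ) < (l - N) * q := by
    rw [lt_div_iff₀ (by linarith)] at hq
    linarith
  have hβ : -(N : ℝ) + (N - l) * q = -N - (l - N) * q := by ring
  obtain ⟨g, c, hg, hc, hg0, hg1, hgA⟩ := A.exists_moment_kernel hell hcan
  obtain ⟨M, hMtop, hM⟩ := HardySobolev.isUniformlyBoundedKernel_majorant hN hq1 hs0 hsq
  have hK1 : ∀ x y, x ≠ y → ‖K x y‖ ≤ |C| * ‖x - y‖ ^ (l - N) := fun x y h =>
    (hK x y h).trans (by gcongr; exact le_abs_self C)
  have hK1' : ∀ x y, x ≠ y → ‖fderiv ℝ (K x) y‖ ≤ |C| * ‖x - y‖ ^ (l - N - 1) := fun x y h =>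
    (hK' x y h).trans (by gcongr; exact le_abs_self C)
  set B : ENNReal := ENNReal.ofReal (|C| * (2 ^ (1 - (l - N)) + c + 1)) ^ q * M with hB
  have hBtop : B ≠ ⊤ := ENNReal.mul_ne_top
    (ENNReal.rpow_ne_top_of_nonneg hq0.le ENNReal.ofReal_ne_top) hMtop
  -- The summand 1 only makes the constant strictly positive.
  refine ⟨B.toReal ^ (1 / q) + 1, by positivity, fun u hu huc => ?_⟩
  have hf := A.continuous_apply hu huc
  have hfc := A.hasCompactSupport_apply hu huc
  have hfI : Integrable (A.apply u) := hf.integrable_of_hasCompactSupport hfc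
  have key := HardySobolev.lintegral_enorm_integral_rpow_le hN (abs_nonneg C) hc hq1 hs0 hsN hM
    hK1 hKdiff hK1' hg hg0 hg1 hf hfc (hgA u hu huc)
  rw [← hB, ← hβ] at key
  have hnn : ∀ x : HardySobolev.Space N,
      0 ≤ ‖∫ y, K x y (A.apply u y)‖ ^ q * ‖x‖ ^ (-(N : ℝ) + (N - l) * q) := fun x => by positivity
  have hoR : ∀ x : HardySobolev.Space N,
      ENNReal.ofReal (‖∫ y, K x y (A.apply u y)‖ ^ q * ‖x‖ ^ (-(N : ℝ) + (N - l) * q))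
        = ‖∫ y, K x y (A.apply u y)‖ₑ ^ q * ENNReal.ofReal (‖x‖ ^ (-(N : ℝ) + (N - l) * q)) :=
    fun x => by
      rw [ENNReal.ofReal_mul (by positivity), ← ENNReal.ofReal_rpow_of_nonneg (norm_nonneg _) hq0.le,
        ofReal_norm]
  have hmeas : AEStronglyMeasurable
      (fun x => ‖∫ y, K x y (A.apply u y)‖ ^ q * ‖x‖ ^ (-(N : ℝ) + (N - l) * q)) := by
    -- Joint measurability of K makes x ↦ ∫ K(x,y) A(D)u(y) dy measurable.
    have h1 : AEStronglyMeasurable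
        (fun p : HardySobolev.Space N × HardySobolev.Space N => K p.1 p.2 (A.apply u p.2))
        ((volume : Measure (HardySobolev.Space N)).prod volume) :=
      (show Continuous (Function.uncurry fun (T : F →L[ℂ] V) (z : F) => T z) from
        isBoundedBilinearMap_apply.continuous).comp_aestronglyMeasurable₂
        hKint.aestronglyMeasurable (hf.comp continuous_snd).aestronglyMeasurable
    have h2 := h1.integral_prod_right'
    exact ((h2.norm.aemeasurable.pow_const q).mul
      (by fun_prop : Measurable fun x : HardySobolev.Space N =>
        ‖x‖ ^ (-(N : ℝ) + (N - l) * q)).aemeasurable).aestronglyMeasurable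
  have hI : ∫⁻ y, ‖A.apply u y‖ₑ ≠ ⊤ := hfI.2.ne
  have htop : B * (∫⁻ y, ‖A.apply u y‖ₑ) ^ q ≠ ⊤ :=
    ENNReal.mul_ne_top hBtop (ENNReal.rpow_ne_top_of_nonneg hq0.le hI)
  refine ⟨fun x => HardySobolev.integrable_apply_of_norm_le_rpow hN hsN (hK x) (hKdiff x) hf hfc,
    ⟨hmeas, ?_⟩, ?_⟩
  · rw [hasFiniteIntegral_iff_ofReal (Filter.Eventually.of_forall hnn)]
    simp_rw [hoR]
    exact key.trans_lt htop.lt_top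
  · rw [integral_eq_lintegral_of_nonneg_ae (Filter.Eventually.of_forall hnn) hmeas,
      integral_norm_eq_lintegral_enorm hfI.1]
    simp_rw [hoR]
    calc _ ≤ (B * (∫⁻ y, ‖A.apply u y‖ₑ) ^ q).toReal ^ (1 / q) := by
          gcongr
      _ = B.toReal ^ (1 / q) * (∫⁻ y, ‖A.apply u y‖ₑ).toReal := by
          rw [ENNReal.toReal_mul, ← ENNReal.toReal_rpow, Real.mul_rpow (by positivity)
            (by positivity), ← Real.rpow_mul (by positivity), mul_one_div_cancel hq0.ne',
            Real.rpow_one]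
      _ ≤ _ := by
          gcongr
          linarith
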